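/- **Games.** Let $X,Y$ be finite sets. A game $G$ consists of a probability distribution $\mu$ on functions $f\colon X\to Y$ (oracles), for each $f$ a discrete probability distribution $\pi_f$ on a set of challenges, and for each oracle $f$ and challenge $\mathsf{ch}$ a set $\mathcal R_{f,\mathsf{ch}}$ of accepting outcomes. A query algorithm (possibly randomized) is given an input, adaptively queries values $f(x)$, and produces an output. For $S,T\in\mathbb N$: * $\varepsilon_G(T)$ is the maximal probability, over $f\sim\mu$, $\mathsf{ch}\sim\pi_f$ and the internal randomness, that an algorithm making at most $T$ queries to $f$ outputs, on input $\mathsf{ch}$, an element of $\mathcal R_{f,\mathsf{ch}}$. * $\varepsilon_G(S,T)$ is the same maximum for algorithms whose input is $(\sigma_f,\mathsf{ch})$, where $\sigma_f\in\{0,1\}^S$ is an advice string that may depend arbitrarily on $f$ (but not on $\mathsf{ch}$). For $K\in\mathbb Z_+$, the salted game $G_K$ has oracle $g=(f_1,\dots,f_K)\colon[K]\times X\to Y$ with $f_1,\dots,f_K\sim\mu$ independent, challenge $(k,\mathsf{ch})$ with $k$ uniform in $[K]$ and $\mathsf{ch}\sim\pi_{f_k}$, and accepting set $\mathcal R_{f_k,\mathsf{ch}}$.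 For $n\in\mathbb N$, the multi-challenge game $G^n$ has oracle $f\sim\mu$, challenge $(\mathsf{ch}^1,\dots,\mathsf{ch}^n)$ with the $\mathsf{ch}^i\sim\pi_f$ independent given $f$, and accepting set $\mathcal R_{f,\mathsf{ch}^1}\times\dots\times\mathcal R_{f,\mathsf{ch}^n}$. **Theorem.** For every game $G$, every $K\in\mathbb Z_+$ and all $S,T\in\mathbb N$, $$ \varepsilon_{G_K}(S,T)\le\inf_{L\in\mathbb Z_+}2^{S/L}\cdot\left(\frac{L!}{K^L}\sum_{\substack{n_1,\dots,n_K\in\mathbb N\\ n_1+\dots+n_K=L}}\ \prod_{k=1}^K\frac{\varepsilon_{G^{n_k}}(n_kT)}{n_k!}\right)^{1/L}. $$ -/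

import Mathlib

open scoped ENNReal Nat

noncomputable section

namespace Salting

/-- A deterministic classical query algorithm on a fixed input: either it stops and outputs an
answer, or it queries the oracle at a point of `X` and continues depending on the value in `Y`. -/
inductive DecisionTree (X Y A : Type*) where
  | output (a : A) : DecisionTree X Y A
  | query (x : X) (next : Y → DecisionTree X Y A) : DecisionTree X Y A

namespace DecisionTree

variable {X Y A : Type*}

/-- The output of the algorithm when its queries are answered by the oracle `f`. -/
def run (f : X → Y) : DecisionTree X Y A → A
  | output a => a
  | query x next => run f (next (f x))

/-- The algorithm makes at most `T` queries, i.e. the tree has depth at most `T`. -/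
def QueriesAtMost : ℕ → DecisionTree X Y A → Prop
  | _, output _ => True
  | 0, query _ _ => False
  | T + 1, query _ next => ∀ y, QueriesAtMost T (next y)

end DecisionTree

/-- A (possibly randomized) classical algorithm making at most `T` queries: on every input
in `I` (the challenge, or the advice together with the challenge) its internal randomness
selects a deterministic query algorithm with at most `T` queries. -/
structure QueryAlgorithm (X Y I A : Type*) (T : ℕ) where
  tree : I → PMF (DecisionTree X Y A)
  queriesAtMost : ∀ i, ∀ t ∈ (tree i).support, t.QueriesAtMost T

theorem tsum_prod_eq_one {α : Type*} (p : PMF α) (n : ℕ) :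
    ∑' v : Fin n → α, ∏ i, p (v i) = 1 := by
  induction n with
  | zero => simp
  | succ n ih =>
    rw [← (Fin.consEquiv (fun _ : Fin (n + 1) => α)).tsum_eq, ENNReal.tsum_prod']
    simp [Fin.consEquiv, Fin.prod_univ_succ, ENNReal.tsum_mul_left, ih, p.tsum_coe]

/-- The joint law of `n` independent samples from `p`. -/
def iid {α : Type*} (n : ℕ) (p : PMF α) : PMF (Fin n → α) :=
  ⟨fun v => ∏ i, p (v i), by
    have h := tsum_prod_eq_one p n
    exact h ▸ ENNReal.summable.hasSum⟩

/-- A game: a distribution `μ` of oracles `X → Y`, a challenge distribution `π f` for every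
oracle `f`, and a set `R f ch` of accepting outcomes for every oracle and challenge. -/
structure Game (X Y C A : Type*) where
  μ : PMF (X → Y)
  π : (X → Y) → PMF C
  R : (X → Y) → C → Set A

namespace Game

variable {X Y C A : Type*}

/-- The experiment of playing the game: sample `f ∼ μ` and `ch ∼ π f`, hand the input
`inp f ch` to the algorithm, run it with oracle access to `f`, and record `(f, ch, answer)`. -/
def play (G : Game X Y C A) {I : Type*} {T : ℕ} (𝒜 : QueryAlgorithm X Y I A T)
    (inp : (X → Y) → C → I) : PMF ((X → Y) × C × A) :=
  G.μ.bind fun f => (G.π f).bind fun ch =>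
    (𝒜.tree (inp f ch)).map fun t => (f, ch, t.run f)

/-- The winning probability: the probability that the answer is in `R f ch`. -/
def winProb (G : Game X Y C A) {I : Type*} {T : ℕ} (𝒜 : QueryAlgorithm X Y I A T)
    (inp : (X → Y) → C → I) : ℝ≥0∞ :=
  (G.play 𝒜 inp).toOuterMeasure {w | w.2.2 ∈ G.R w.1 w.2.1}

/-- The optimal winning probability of algorithms that make at most `T` queries and receive
only the challenge. -/
def eps (G : Game X Y C A) (T : ℕ) : ℝ≥0∞ :=
  ⨆ 𝒜 : QueryAlgorithm X Y C A T, G.winProb 𝒜 fun _ ch => ch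

/-- The optimal winning probability of algorithms that make at most `T` queries and receive,
besides the challenge, an `S`-bit advice string depending arbitrarily on the oracle. -/
def epsAdvice (G : Game X Y C A) (S T : ℕ) : ℝ≥0∞ :=
  ⨆ (𝒜 : QueryAlgorithm X Y ((Fin S → Bool) × C) A T) (σ : (X → Y) → Fin S → Bool),
    G.winProb 𝒜 fun f ch => (σ f, ch)

/-- The salted game `G_K`: the oracle consists of `K` independent oracles from `μ`, and the
challenge is a uniformly random salt `k` together with a challenge for the `k`-th oracle. -/
def salted (G : Game X Y C A) (K : ℕ) [NeZero K] : Game (Fin K × X) Y (Fin K × C) A where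
  μ := (iid K G.μ).map fun fs p => fs p.1 p.2
  π g := (PMF.uniformOfFintype (Fin K)).bind fun k =>
    (G.π fun x => g (k, x)).map fun ch => (k, ch)
  R g ch := G.R (fun x => g (ch.1, x)) ch.2

/-- The multi-challenge game `G^n`: one oracle from `μ` and `n` independent challenges for it,
all of which have to be answered. -/
def multi (G : Game X Y C A) (n : ℕ) : Game X Y (Fin n → C) (Fin n → A) where
  μ := G.μ
  π f := iid n (G.π f)
  R f ch := {a | ∀ i, a i ∈ G.R f (ch i)}

end Game

end Salting

end

/-! Fix an algorithm and let q(s, g) be its success probability on the salted oracle g with advice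
s. By Jensen, the L-th power of the expectation of q(σ(g), g) is at most that of q(σ(g), g)^L, hence
at most the sum over all 2^S strings s of the expectation of q(s, g)^L, where s no longer depends on
g. Taking L-th roots gives the factor 2^(S/L).

For fixed s, q is the average over k of the success probability on salt k, so the multinomial
theorem expands q^L into products of n_k-th powers. Such a power is the probability that n_k
independent runs on independent challenges all succeed; performed in sequence, the runs use n_k T
queries. What remains is a direct product theorem (`sum_prod_run_le_prod_bestWeight`): K algorithms,
the k-th answering for f_k but allowed to query every f_j, jointly succeed with probability at most
the product of their separate optima.

That theorem goes by induction on the remaining work. When every active tree starts with a query to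
an active oracle, the map from trees to queried oracles permutes some nonempty set c. Carrying out
these queries at once costs each tree in c one query and reveals one value of each oracle in c, so
the product structure survives. -/

namespace Salting

/-! ### Exchanging sums and suprema; cycles of self-maps -/

/-- A sum of suprema is a supremum of sums, when the summands can be optimized independently. -/
theorem sum_iSup_le_iSup_sum {α β : Type*} (s : Finset α) (g : α → β → ℝ≥0∞) :
    ∑ a ∈ s, ⨆ b, g a b ≤ ⨆ t : α → β, ∑ a ∈ s, g a (t a) := by
  classical
  rcases isEmpty_or_nonempty β with hβ | ⟨⟨b₀⟩⟩
  · simp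
  -- Directedness: of two choice functions, keep the better value in each coordinate.
  have h := ENNReal.finsetSum_iSup (s := s) (f := fun a (t : α → β) => g a (t a)) (by
    intro t₁ t₂
    refine ⟨fun a => if g a (t₁ a) ≤ g a (t₂ a) then t₂ a else t₁ a, fun a => ?_⟩
    dsimp only
    split_ifs with h
    · exact ⟨h, le_rfl⟩
    · exact ⟨le_rfl, (not_le.mp h).le⟩)
  rw [← h]
  refine Finset.sum_le_sum fun a _ => iSup_le fun b => ?_
  exact le_iSup (fun t : α → β => g a (t a)) (fun _ => b)

theorem tsum_iSup_le_iSup_tsum {α β : Type*} (g : α → β → ℝ≥0∞) :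
    ∑' a, ⨆ b, g a b ≤ ⨆ t : α → β, ∑' a, g a (t a) := by
  rw [ENNReal.tsum_eq_iSup_sum]
  refine iSup_le fun s => (sum_iSup_le_iSup_sum s g).trans ?_
  exact iSup_mono fun t => ENNReal.sum_le_tsum s

/-- Every self-map of a nonempty finite set restricts to a permutation of a nonempty subset. -/
theorem exists_bijOn_subset {ι : Type*} [DecidableEq ι] (s : Finset ι) (hs : s.Nonempty)
    (j : ι → ι) (hj : ∀ k ∈ s, j k ∈ s) :
    ∃ c ⊆ s, c.Nonempty ∧ Set.BijOn j c c := by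
  induction s using Finset.strongInduction with
  | H s ih =>
    have hsub : s.image j ⊆ s := Finset.image_subset_iff.mpr hj
    by_cases h : s.image j = s
    · refine ⟨s, subset_rfl, hs, fun k hk => hj k hk, ?_, ?_⟩
      · exact Finset.card_image_iff.mp (by rw [h])
      · intro b hb
        rw [← h] at hb
        simpa using hb
    · obtain ⟨c, hc, hne, hb⟩ := ih _ (Finset.ssubset_iff_subset_ne.mpr ⟨hsub, h⟩) (hs.image j)
        fun k hk => Finset.mem_image_of_mem j (hsub hk)
      exact ⟨c, hc.trans hsub, hne, hb⟩

/-! ### Composition of decision trees and their optimal weight -/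

namespace DecisionTree

variable {X Y A B : Type*}

@[simp] theorem queriesAtMost_output (T : ℕ) (a : A) :
    (output a : DecisionTree X Y A).QueriesAtMost T := by
  cases T <;> trivial

@[simp] theorem queriesAtMost_succ_query (T : ℕ) (x : X) (next : Y → DecisionTree X Y A) :
    (query x next).QueriesAtMost (T + 1) ↔ ∀ y, (next y).QueriesAtMost T := Iff.rfl

@[simp] theorem not_queriesAtMost_zero_query (x : X) (next : Y → DecisionTree X Y A) :
    ¬ (query x next).QueriesAtMost 0 := id

theorem QueriesAtMost.mono {t : DecisionTree X Y A} {m n : ℕ} (h : t.QueriesAtMost m)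
    (hmn : m ≤ n) : t.QueriesAtMost n := by
  induction t generalizing m n with
  | output a => simp
  | query x next ih =>
    obtain _ | m := m
    · simp at h
    obtain _ | n := n
    · omega
    exact fun y => ih y (h y) (by omega)

/-- Run `t`, then continue with a second algorithm that depends on its output. -/
def bind : DecisionTree X Y A → (A → DecisionTree X Y B) → DecisionTree X Y B
  | output a, k => k a
  | query x next, k => query x fun y => bind (next y) k

theorem run_bind (f : X → Y) (t : DecisionTree X Y A) (k : A → DecisionTree X Y B) :
    (t.bind k).run f = (k (t.run f)).run f := by
  induction t with
  | output a => rfl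
  | query x next ih => exact ih (f x)

theorem QueriesAtMost.bind {t : DecisionTree X Y A} {k : A → DecisionTree X Y B} {m n : ℕ}
    (ht : t.QueriesAtMost m) (hk : ∀ a, (k a).QueriesAtMost n) :
    (t.bind k).QueriesAtMost (m + n) := by
  induction t generalizing m with
  | output a => exact (hk a).mono (by omega)
  | query x next ih =>
    obtain _ | m := m
    · simp at ht
    rw [Nat.succ_add]
    exact fun y => ih y (ht y)

/-- Run finitely many algorithms one after the other and output all their answers. -/
def sequence : (n : ℕ) → (Fin n → DecisionTree X Y A) → DecisionTree X Y (Fin n → A)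
  | 0, _ => output Fin.elim0
  | n + 1, t => (t 0).bind fun a => (sequence n (Fin.tail t)).bind fun v => output (Fin.cons a v)

theorem run_sequence (f : X → Y) (n : ℕ) (t : Fin n → DecisionTree X Y A) :
    (sequence n t).run f = fun i => (t i).run f := by
  induction n with
  | zero => exact Subsingleton.elim _ _
  | succ n ih =>
    rw [sequence, run_bind, run_bind, ih]
    funext i
    refine Fin.cases rfl (fun i => rfl) i

theorem queriesAtMost_sequence (n : ℕ) (t : Fin n → DecisionTree X Y A) {T : ℕ}
    (h : ∀ i, (t i).QueriesAtMost T) : (sequence n t).QueriesAtMost (n * T) := by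
  induction n with
  | zero => simp [sequence]
  | succ n ih =>
    refine QueriesAtMost.mono (m := T + (n * T + 0)) ?_ (by rw [Nat.succ_mul]; omega)
    exact (h 0).bind fun a => (ih (Fin.tail t) fun i => h i.succ).bind fun v => by simp

/-- The largest total weight that an algorithm with at most `T` queries can collect on the
oracles in `D`, where answering `a` for the oracle `f` is worth `w f a`. -/
noncomputable def bestWeight (T : ℕ) (D : Finset (X → Y)) (w : (X → Y) → A → ℝ≥0∞) : ℝ≥0∞ :=
  ⨆ t : {t : DecisionTree X Y A // t.QueriesAtMost T}, ∑ f ∈ D, w f (t.1.run f)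

theorem le_bestWeight {T : ℕ} (D : Finset (X → Y)) (w : (X → Y) → A → ℝ≥0∞)
    {t : DecisionTree X Y A} (ht : t.QueriesAtMost T) :
    ∑ f ∈ D, w f (t.run f) ≤ bestWeight T D w :=
  le_iSup (fun t : {t : DecisionTree X Y A // t.QueriesAtMost T} => ∑ f ∈ D, w f (t.1.run f))
    ⟨t, ht⟩

theorem bestWeight_mono {m n : ℕ} (hmn : m ≤ n) {D D' : Finset (X → Y)} (hD : D ⊆ D')
    (w : (X → Y) → A → ℝ≥0∞) : bestWeight m D w ≤ bestWeight n D' w :=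
  iSup_le fun t => (Finset.sum_le_sum_of_subset hD).trans (le_bestWeight D' w (t.2.mono hmn))

/-- Querying `x` first is at best optimal. -/
theorem sum_bestWeight_filter_le [DecidableEq Y] (T : ℕ) (D : Finset (X → Y))
    (w : (X → Y) → A → ℝ≥0∞) (x : X) (B : Finset Y) :
    ∑ y ∈ B, bestWeight T (D.filter fun f => f x = y) w ≤ bestWeight (T + 1) D w := by
  refine (sum_iSup_le_iSup_sum B _).trans (iSup_le fun t => ?_)
  calc ∑ y ∈ B, ∑ f ∈ D.filter (fun f => f x = y), w f ((t y).1.run f)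
      = ∑ y ∈ B, ∑ f ∈ D.filter (fun f => f x = y), w f ((t (f x)).1.run f) := by
        refine Finset.sum_congr rfl fun y _ => Finset.sum_congr rfl fun f hf => ?_
        rw [(Finset.mem_filter.mp hf).2]
    _ = ∑ f ∈ D.filter (fun f => f x ∈ B), w f ((t (f x)).1.run f) :=
        Finset.sum_fiberwise_eq_sum_filter D B (fun f => f x) _
    _ ≤ ∑ f ∈ D, w f ((t (f x)).1.run f) :=
        Finset.sum_le_sum_of_subset (Finset.filter_subset _ _)
    _ ≤ bestWeight (T + 1) D w :=
        le_bestWeight D w (t := query x fun y => (t y).1) fun y => (t y).2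

/-! ### The direct product theorem -/

section DirectProduct

variable {ι : Type*} [Fintype ι] [DecidableEq ι] {A : ι → Type*}

theorem sum_piFinset_eq_sum_fiber {α β : Type*} [DecidableEq α] [DecidableEq β]
    (D : ι → Finset α) (r : ι → α → β) (F : (ι → α) → ℝ≥0∞) :
    ∑ fs ∈ Fintype.piFinset D, F fs =
      ∑ a ∈ Fintype.piFinset fun k => (D k).image (r k),
        ∑ fs ∈ Fintype.piFinset fun k => (D k).filter fun f => r k f = a k, F fs := by
  rw [← Finset.sum_fiberwise_of_maps_to (g := fun fs k => r k (fs k))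
    (t := Fintype.piFinset fun k => (D k).image (r k))]
  · refine Finset.sum_congr rfl fun a _ => Finset.sum_congr ?_ fun _ _ => rfl
    ext fs
    simp [funext_iff, forall_and]
  · intro fs hfs
    rw [Fintype.mem_piFinset] at hfs ⊢
    exact fun k => Finset.mem_image_of_mem _ (hfs k)

/-- The direct product theorem for decision forests (Nisan, Rudich, Saks): if the `k`-th tree has
to answer for the `k`-th of several independent oracles, then access to the other oracles does
not help. The oracles outside `s` are fixed. -/
theorem sum_prod_run_le_prod_bestWeight (w : ∀ k, (X → Y) → A k → ℝ≥0∞) (N : ℕ) :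
    ∀ (s : Finset ι) (T : ι → ℕ) (D : ι → Finset (X → Y))
      (t : ∀ k, DecisionTree (ι × X) Y (A k)),
      (∀ k ∈ s, (t k).QueriesAtMost (T k)) → (∀ k ∉ s, (D k).card ≤ 1) →
      ∑ k ∈ s, (T k + 1) ≤ N →
      ∑ fs ∈ Fintype.piFinset D, ∏ k ∈ s, w k (fs k) ((t k).run fun p => fs p.1 p.2) ≤
        ∏ k ∈ s, bestWeight (T k) (D k) (w k) := by
  classical
  induction N with
  | zero =>
    intro s T D t ht hD hN
    -- The `+ 1` in the measure charges for the final output as well, so measure zero leaves no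
    -- active tree.
    have hs : s = ∅ := by
      by_contra h
      obtain ⟨k, hk⟩ := Finset.nonempty_iff_ne_empty.mpr h
      have := Finset.single_le_sum (f := fun k => T k + 1) (fun _ _ => Nat.zero_le _) hk
      omega
    subst hs
    simp only [Finset.prod_empty, Finset.sum_const, Fintype.card_piFinset, nsmul_eq_mul, mul_one]
    exact_mod_cast Finset.prod_le_one' fun k _ => hD k (by simp)
  | succ N ih =>
    intro s T D t ht hD hN
    by_cases hout : ∃ k ∈ s, ∃ a, t k = output a
    · obtain ⟨k, hk, a, hka⟩ := hout
      have hfib (f) (hf : f ∈ D k) : (Fintype.piFinset D).filter (fun fs => fs k = f) =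
          Fintype.piFinset (Function.update D k {f}) := by
        ext fs
        simp only [Finset.mem_filter, Fintype.mem_piFinset]
        constructor
        · rintro ⟨h, rfl⟩ l
          rcases eq_or_ne l k with rfl | hl
          · simp
          · simpa [hl] using h l
        · intro h
          have hk' : fs k = f := by simpa using h k
          refine ⟨fun l => ?_, hk'⟩
          rcases eq_or_ne l k with rfl | hl
          · rwa [hk']
          · simpa [hl] using h l
      rw [← Finset.sum_fiberwise_of_maps_to (g := fun fs => fs k) (t := D k)
        fun fs hfs => Fintype.mem_piFinset.mp hfs k]
      calc ∑ f ∈ D k, ∑ fs ∈ Fintype.piFinset D with fs k = f,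
            ∏ l ∈ s, w l (fs l) ((t l).run fun p => fs p.1 p.2)
          ≤ ∑ f ∈ D k, w k f a * ∏ l ∈ s.erase k, bestWeight (T l) (D l) (w l) := by
            refine Finset.sum_le_sum fun f hf => ?_
            have key := ih (s.erase k) T (Function.update D k {f}) t
              (fun l hl => ht l (Finset.mem_of_mem_erase hl)) (fun l hl => ?_) ?_
            · have hV : ∏ l ∈ s.erase k, bestWeight (T l) (Function.update D k {f} l) (w l) =
                  ∏ l ∈ s.erase k, bestWeight (T l) (D l) (w l) :=
                Finset.prod_congr rfl fun l hl => by
                  rw [Function.update_of_ne (Finset.ne_of_mem_erase hl)]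
              rw [hV] at key
              refine le_trans (le_of_eq ?_) (mul_le_mul_right key (w k f a))
              rw [← hfib f hf, Finset.mul_sum]
              refine Finset.sum_congr rfl fun fs hfs => ?_
              rw [← Finset.mul_prod_erase s _ hk, (Finset.mem_filter.mp hfs).2, hka, run]
            · rcases eq_or_ne l k with rfl | hlk
              · simp
              · simpa [hlk] using hD l fun h => hl (Finset.mem_erase.mpr ⟨hlk, h⟩)
            · rw [← Finset.add_sum_erase s _ hk] at hN
              omega
        _ = (∑ f ∈ D k, w k f a) * ∏ l ∈ s.erase k, bestWeight (T l) (D l) (w l) :=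
            (Finset.sum_mul ..).symm
        _ ≤ bestWeight (T k) (D k) (w k) * ∏ l ∈ s.erase k, bestWeight (T l) (D l) (w l) :=
            mul_le_mul_left (le_bestWeight (D k) (w k) (queriesAtMost_output (T k) a)) _
        _ = _ := Finset.mul_prod_erase s (fun l => bestWeight (T l) (D l) (w l)) hk
    by_cases hfix : ∃ k ∈ s, ∃ p next, t k = query p next ∧ p.1 ∉ s
    · obtain ⟨k, hk, ⟨j, x⟩, next, hkq, hj⟩ := hfix
      rcases (Fintype.piFinset D).eq_empty_or_nonempty with hemp | ⟨gs, hgs⟩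
      · simp [hemp]
      rw [Fintype.mem_piFinset] at hgs
      have hkT := ht k hk
      rw [hkq] at hkT
      obtain ⟨m, hm⟩ : ∃ m, T k = m + 1 := by
        rcases h : T k with _ | m
        · simp [h] at hkT
        · exact ⟨m, rfl⟩
      rw [hm] at hkT
      refine le_trans (le_of_eq ?_) ((ih s (Function.update T k m) D
        (Function.update t k (next (gs j x))) ?_ hD ?_).trans ?_)
      · refine Finset.sum_congr rfl fun fs hfs => Finset.prod_congr rfl fun l _ => ?_
        rcases eq_or_ne l k with rfl | hl
        · have : fs j = gs j := Finset.card_le_one.mp (hD j hj) _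
            (Fintype.mem_piFinset.mp hfs j) _ (hgs j)
          rw [Function.update_self, hkq, run, this]
        · rw [Function.update_of_ne hl]
      · intro l hl
        rcases eq_or_ne l k with rfl | hlk
        · simpa using hkT _
        · simpa [hlk] using ht l hl
      · have : ∑ l ∈ s, (Function.update T k m l + 1) < ∑ l ∈ s, (T l + 1) := by
          refine Finset.sum_lt_sum (fun l _ => ?_) ⟨k, hk, by simp [hm]⟩
          rcases eq_or_ne l k with rfl | hlk
          · simp [hm]
          · simp [hlk]
        omega
      · refine Finset.prod_le_prod' fun l _ => bestWeight_mono ?_ subset_rfl _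
        rcases eq_or_ne l k with rfl | hlk
        · simp [hm]
        · simp [hlk]
    rcases s.eq_empty_or_nonempty with rfl | hs
    · exact ih ∅ T D t (by simp) hD (by simp)
    have hq (k) (hk : k ∈ s) : ∃ p next, t k = query p next ∧ p.1 ∈ s := by
      rcases hkt : t k with a | ⟨p, next⟩
      · exact (hout ⟨k, hk, a, hkt⟩).elim
      · refine ⟨p, next, rfl, ?_⟩
        by_contra hp
        exact hfix ⟨k, hk, p, next, hkt, hp⟩
    have : Nonempty (ι × X) := ⟨(hq _ hs.choose_spec).choose⟩
    have : Nonempty (Y → DecisionTree (ι × X) Y (A hs.choose)) :=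
      ⟨(hq _ hs.choose_spec).choose_spec.choose⟩
    choose! p hp using hq
    choose next hqt hps using hp
    -- On `c`, each oracle is queried by exactly one tree of `c`, its `pred`.
    obtain ⟨c, hcs, hcne, hmaps, hinj, hsurj⟩ := exists_bijOn_subset s hs (fun k => (p k).1) hps
    have hpre (i) (hi : i ∈ c) : ∃ k, k ∈ c ∧ (p k).1 = i := hsurj hi
    choose! pred hpredc hpred using hpre
    have hpj (k) (hk : k ∈ c) : pred (p k).1 = k :=
      hinj (hpredc _ (hmaps hk)) hk (hpred _ (hmaps hk))
    -- The information revealed about oracle `l`: its value at the point asked by `pred l`, or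
    -- nothing (`none`) off `c`.
    set r : ι → (X → Y) → Option Y := fun l f => if l ∈ c then some (f (p (pred l)).2) else none
      with hr
    let T' : ι → ℕ := fun k => if k ∈ c then T k - 1 else T k
    -- The `none` branch on `c` is a dummy: the labels summed over lie in the image of `r`, hence
    -- are `some` there.
    let t' : (ι → Option Y) → ∀ k, DecisionTree (ι × X) Y (A k) := fun a k =>
      if hk : k ∈ c then (a (p k).1).elim (t k) (next k (hcs hk)) else t k
    have hTc (k) (hk : k ∈ c) : T k = T' k + 1 := by
      have hkT := ht k (hcs hk)
      rw [hqt k (hcs hk)] at hkT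
      rcases h : T k with _ | m
      · simp [h] at hkT
      · simp [T', hk, h]
    have hsum : ∑ l ∈ s, (T' l + 1) ≤ N := by
      have : ∑ l ∈ s, (T' l + 1) < ∑ l ∈ s, (T l + 1) := by
        obtain ⟨k, hk⟩ := hcne
        refine Finset.sum_lt_sum (fun l _ => ?_) ⟨k, hcs hk, by simp [hTc k hk]⟩
        by_cases hl : l ∈ c
        · simp [hTc l hl]
        · simp [T', hl]
      omega
    rw [sum_piFinset_eq_sum_fiber D r]
    calc ∑ a ∈ Fintype.piFinset fun k => (D k).image (r k),
          ∑ fs ∈ Fintype.piFinset fun k => (D k).filter fun f => r k f = a k,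
            ∏ k ∈ s, w k (fs k) ((t k).run fun p => fs p.1 p.2)
        ≤ ∑ a ∈ Fintype.piFinset fun k => (D k).image (r k),
          ∏ k ∈ s, bestWeight (T' k) ((D k).filter fun f => r k f = a k) (w k) := by
          refine Finset.sum_le_sum fun a ha => ?_
          rw [Fintype.mem_piFinset] at ha
          refine le_trans (le_of_eq ?_) (ih s T' _ (t' a) ?_ ?_ hsum)
          · refine Finset.sum_congr rfl fun fs hfs => Finset.prod_congr rfl fun k hk => ?_
            congr 1
            by_cases hkc : k ∈ c
            · have h := (Finset.mem_filter.mp (Fintype.mem_piFinset.mp hfs (p k).1)).2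
              have hjc : (p k).1 ∈ c := hmaps hkc
              simp only [hr, hjc, if_true, hpj k hkc] at h
              simp only [t', hkc, dif_pos, ← h, Option.elim]
              conv_lhs => rw [hqt k hk, run]
            · simp [t', hkc]
          · intro k hk
            by_cases hkc : k ∈ c
            · have hkT := ht k hk
              rw [hqt k hk, hTc k hkc] at hkT
              obtain ⟨f, -, hf⟩ := Finset.mem_image.mp (ha (p k).1)
              have hjc : (p k).1 ∈ c := hmaps hkc
              simp only [hr, hjc, if_true] at hf
              simp only [t', hkc, dif_pos, ← hf, Option.elim]
              exact hkT _
            · simpa [t', T', hkc] using ht k hk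
          · exact fun k hk => (Finset.card_le_card (Finset.filter_subset _ _)).trans (hD k hk)
      _ = ∑ a ∈ Fintype.piFinset fun k => (D k).image (r k), ∏ k, if k ∈ s then
            bestWeight (T' k) ((D k).filter fun f => r k f = a k) (w k) else 1 := by
          refine Finset.sum_congr rfl fun a _ => ?_
          rw [Finset.prod_ite_mem, Finset.univ_inter]
      _ = ∏ k, ∑ y ∈ (D k).image (r k), if k ∈ s then
            bestWeight (T' k) ((D k).filter fun f => r k f = y) (w k) else 1 :=
          (Finset.prod_univ_sum _ fun k y => if k ∈ s then
            bestWeight (T' k) ((D k).filter fun f => r k f = y) (w k) else 1).symm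
      _ ≤ ∏ k, if k ∈ s then bestWeight (T k) (D k) (w k) else 1 := by
          -- On `c`, the lost query of tree `k` pays for the split of `D k`: an algorithm for oracle
          -- `k` alone with budget `T k` could ask that point itself.
          refine Finset.prod_le_prod' fun k _ => ?_
          by_cases hkc : k ∈ c
          · have himg : (D k).image (r k) =
                ((D k).image fun f => f (p (pred k)).2).map Function.Embedding.some := by
              ext
              simp [hr, hkc]
            rw [himg, Finset.sum_map, if_pos (hcs hkc), hTc k hkc]
            simp only [if_pos (hcs hkc), hr, if_pos hkc, Function.Embedding.some_apply,
              Option.some_inj]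
            exact sum_bestWeight_filter_le _ _ _ _ _
          · have himg : (D k).image (r k) ⊆ {none} := by
              intro y hy
              obtain ⟨f, -, rfl⟩ := Finset.mem_image.mp hy
              simp [hr, hkc]
            refine (Finset.sum_le_sum_of_subset himg).trans ?_
            rw [Finset.sum_singleton]
            split_ifs
            · exact bestWeight_mono (by simp [T', hkc]) (Finset.filter_subset _ _) _
            · exact le_rfl
      _ = ∏ k ∈ s, bestWeight (T k) (D k) (w k) := by
          rw [Finset.prod_ite_mem, Finset.univ_inter]

end DirectProduct

end DecisionTree

/-! ### Products of infinite sums and the multinomial expansion -/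

theorem prod_tsum_eq_tsum_prod (n : ℕ) {α : Fin n → Type*} (F : ∀ i, α i → ℝ≥0∞) :
    ∏ i, ∑' a, F i a = ∑' v : ∀ i, α i, ∏ i, F i (v i) := by
  induction n with
  | zero => simp
  | succ n ih =>
    rw [← (Fin.consEquiv α).tsum_eq, ENNReal.tsum_prod', Fin.prod_univ_succ, ih,
      ← ENNReal.tsum_mul_right]
    refine tsum_congr fun a => ?_
    rw [← ENNReal.tsum_mul_left]
    refine tsum_congr fun v => ?_
    simp [Fin.consEquiv, Fin.prod_univ_succ]

theorem iid_apply {α : Type*} (n : ℕ) (p : PMF α) (v : Fin n → α) :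
    iid n p v = ∏ i, p (v i) := rfl

theorem sum_pow_eq_sum_piAntidiag_factorial {ι : Type*} [DecidableEq ι] (s : Finset ι)
    (x : ι → ℝ≥0∞) (L : ℕ) :
    (∑ i ∈ s, x i) ^ L =
      (L ! : ℝ≥0∞) * ∑ n ∈ s.piAntidiag L, (∏ i ∈ s, ((n i)! : ℝ≥0∞)⁻¹) * ∏ i ∈ s, x i ^ n i := by
  rw [Finset.sum_pow_eq_sum_piAntidiag, Finset.mul_sum]
  refine Finset.sum_congr rfl fun n hn => ?_
  rw [← mul_assoc]
  congr 1
  have h := Nat.multinomial_spec s n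
  rw [(Finset.mem_piAntidiag.mp hn).1] at h
  have hne : (∏ i ∈ s, ((n i)! : ℝ≥0∞)) ≠ 0 :=
    Finset.prod_ne_zero_iff.mpr fun i _ => by exact_mod_cast (n i).factorial_ne_zero
  have htop : (∏ i ∈ s, ((n i)! : ℝ≥0∞)) ≠ ∞ :=
    ENNReal.prod_ne_top fun i _ => ENNReal.natCast_ne_top _
  rw [← ENNReal.prod_inv_distrib (fun i _ j _ _ => Or.inr (ENNReal.natCast_ne_top _)), ← h]
  push_cast
  rw [mul_right_comm, ENNReal.mul_inv_cancel hne htop, one_mul]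

/-! ### From decision trees to games -/

namespace Game

variable {X Y C A : Type*}

open DecisionTree

theorem winProb_eq (G : Game X Y C A) {I : Type*} {T : ℕ} (𝒜 : QueryAlgorithm X Y I A T)
    (inp : (X → Y) → C → I) :
    G.winProb 𝒜 inp = ∑' f, G.μ f * ∑' ch, G.π f ch *
      ∑' t, 𝒜.tree (inp f ch) t * (G.R f ch).indicator 1 (t.run f) := by
  simp only [winProb, play, PMF.toOuterMeasure_bind_apply, PMF.toOuterMeasure_map_apply]
  simp only [PMF.toOuterMeasure_apply]
  refine tsum_congr fun f => ?_
  congr 1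
  refine tsum_congr fun ch => ?_
  congr 1
  refine tsum_congr fun t => ?_
  by_cases h : t.run f ∈ G.R f ch <;> simp [Set.indicator, h]

/-- The weight of the oracle `f` for the answer `a` to the challenge `ch`. -/
noncomputable def weight (G : Game X Y C A) (ch : C) (f : X → Y) (a : A) : ℝ≥0∞ :=
  G.μ f * (G.π f ch * (G.R f ch).indicator 1 a)

/-- The tree may be optimized separately for each challenge, and the resulting choice function is
itself a deterministic algorithm for the game. -/
theorem tsum_bestWeight_le_eps [Fintype (X → Y)] (G : Game X Y C A) (T : ℕ) :
    ∑' ch, bestWeight T Finset.univ (G.weight ch) ≤ G.eps T := by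
  refine (tsum_iSup_le_iSup_tsum _).trans (iSup_le fun t => ?_)
  let 𝒜 : QueryAlgorithm X Y C A T :=
    ⟨fun ch => PMF.pure (t ch).1, fun ch t' ht' => by
      rw [PMF.support_pure, Set.mem_singleton_iff] at ht'
      exact ht' ▸ (t ch).2⟩
  refine le_trans (le_of_eq ?_) (le_iSup (fun 𝒜 => G.winProb 𝒜 fun _ ch => ch) 𝒜)
  rw [winProb_eq, Summable.tsum_finsetSum fun _ _ => ENNReal.summable, tsum_fintype]
  refine Finset.sum_congr rfl fun f _ => ?_
  rw [← ENNReal.tsum_mul_left]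
  refine tsum_congr fun ch => ?_
  rw [weight]
  congr 2
  rw [tsum_eq_single (t ch).1 fun t' ht' => by simp [𝒜, ht']]
  simp [𝒜]

/-- The winning probability for the oracle `f` when the tree is drawn from `τ ch` and its queries
are answered by `g`. -/
noncomputable def answerProb {Z : Type*} (G : Game X Y C A) (τ : C → PMF (DecisionTree Z Y A)) (f : X → Y)
    (g : Z → Y) : ℝ≥0∞ :=
  ∑' ch, G.π f ch * ∑' t, τ ch t * (G.R f ch).indicator 1 (t.run g)

theorem winProb_salted (G : Game X Y C A) (K : ℕ) [NeZero K] {I : Type*} {T : ℕ}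
    (𝒜 : QueryAlgorithm (Fin K × X) Y I A T) (inp : (Fin K × X → Y) → Fin K × C → I) :
    (G.salted K).winProb 𝒜 inp = ∑' fs, iid K G.μ fs * ((K : ℝ≥0∞)⁻¹ * ∑ k,
      G.answerProb (fun ch => 𝒜.tree (inp (fun p => fs p.1 p.2) (k, ch))) (fs k)
        fun p => fs p.1 p.2) := by
  simp only [winProb, play, salted, PMF.bind_map, PMF.bind_bind, Function.comp_def,
    PMF.toOuterMeasure_bind_apply, PMF.toOuterMeasure_map_apply]
  simp only [PMF.toOuterMeasure_apply, tsum_fintype, PMF.uniformOfFintype_apply,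
    Fintype.card_fin, answerProb, ← Finset.mul_sum]
  refine tsum_congr fun fs => ?_
  congr 2
  refine Finset.sum_congr rfl fun k _ => tsum_congr fun ch => ?_
  congr 1
  refine tsum_congr fun t => ?_
  by_cases h : t.run (fun p => fs p.1 p.2) ∈ G.R (fs k) ch <;> simp [Set.indicator, h]

/-- The optimum depends only on the challenges, so the randomness in `Z` sums out to one. -/
theorem tsum_prod_mul_bestWeight_le_eps [Fintype (X → Y)] (G : Game X Y C A) {Z : Type*}
    (τ : C → PMF Z) (n m : ℕ) :
    ∑' v : Fin n → C × Z, (∏ i, τ (v i).1 (v i).2) *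
      bestWeight m Finset.univ ((G.multi n).weight fun i => (v i).1) ≤ (G.multi n).eps m := by
  refine le_trans (le_of_eq ?_) ((G.multi n).tsum_bestWeight_le_eps m)
  rw [← (Equiv.arrowProdEquivProdArrow (Fin n) (fun _ => C) fun _ => Z).symm.tsum_eq,
    ENNReal.tsum_prod']
  refine tsum_congr fun ch => ?_
  simp only [Equiv.arrowProdEquivProdArrow, Equiv.coe_fn_symm_mk, ENNReal.tsum_mul_right]
  rw [← prod_tsum_eq_tsum_prod n fun i => τ (ch i)]
  simp [PMF.tsum_coe]

/-- Independent copies of an algorithm for the salted game cannot answer several challenges for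
each salt better than algorithms that play the multi-challenge games separately. -/
theorem sum_iid_mul_prod_answerProb_pow_le [Fintype (X → Y)] (G : Game X Y C A) (K T : ℕ)
    (τ : Fin K → C → PMF (DecisionTree (Fin K × X) Y A))
    (hτ : ∀ k ch, ∀ t ∈ (τ k ch).support, t.QueriesAtMost T) (n : Fin K → ℕ) :
    ∑ fs, iid K G.μ fs * ∏ k, G.answerProb (τ k) (fs k) (fun p => fs p.1 p.2) ^ n k ≤
      ∏ k, (G.multi (n k)).eps (n k * T) := by
  classical
  have hpow (fs : Fin K → X → Y) (k : Fin K) :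
      G.answerProb (τ k) (fs k) (fun p => fs p.1 p.2) ^ n k =
        ∑' v : Fin (n k) → C × DecisionTree (Fin K × X) Y A, ∏ i, (G.π (fs k) (v i).1 *
          (τ k (v i).1 (v i).2 *
            (G.R (fs k) (v i).1).indicator 1 ((v i).2.run fun p => fs p.1 p.2))) := by
    rw [← prod_tsum_eq_tsum_prod (n k) fun _ (a : C × DecisionTree (Fin K × X) Y A) =>
      G.π (fs k) a.1 * (τ k a.1 a.2 *
        (G.R (fs k) a.1).indicator 1 (a.2.run fun p => fs p.1 p.2)), Finset.prod_const,
      Finset.card_univ, Fintype.card_fin, ENNReal.tsum_prod']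
    simp only [answerProb, ENNReal.tsum_mul_left]
  have hind (f) {m : ℕ} (chs : Fin m → C) (a : Fin m → A) :
      ∏ i, (G.R f (chs i)).indicator (1 : A → ℝ≥0∞) (a i) =
        ((G.multi m).R f chs).indicator 1 a := by
    by_cases h : a ∈ (G.multi m).R f chs
    · rw [Set.indicator_of_mem h]
      exact Finset.prod_eq_one fun i _ => Set.indicator_of_mem (h i) _
    · rw [Set.indicator_of_notMem h]
      obtain ⟨i, hi⟩ := not_forall.mp h
      exact Finset.prod_eq_zero (Finset.mem_univ i) (Set.indicator_of_notMem hi _)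
  calc ∑ fs, iid K G.μ fs * ∏ k, G.answerProb (τ k) (fs k) (fun p => fs p.1 p.2) ^ n k
      = ∑' v : ∀ k, Fin (n k) → C × DecisionTree (Fin K × X) Y A,
          (∏ k, ∏ i, τ k (v k i).1 (v k i).2) * ∑ fs : Fin K → X → Y, ∏ k,
            (G.multi (n k)).weight (fun i => (v k i).1) (fs k)
              ((sequence (n k) fun i => (v k i).2).run fun p => fs p.1 p.2) := by
        simp only [hpow, Finset.mul_sum]
        rw [Summable.tsum_finsetSum fun _ _ => ENNReal.summable]
        refine Finset.sum_congr rfl fun fs _ => ?_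
        rw [prod_tsum_eq_tsum_prod, ← ENNReal.tsum_mul_left]
        refine tsum_congr fun v => ?_
        rw [iid_apply, ← Finset.prod_mul_distrib, ← Finset.prod_mul_distrib]
        refine Finset.prod_congr rfl fun k _ => ?_
        rw [weight, run_sequence, ← hind]
        simp only [Finset.prod_mul_distrib, multi, iid_apply]
        ring
    _ ≤ ∑' v : ∀ k, Fin (n k) → C × DecisionTree (Fin K × X) Y A,
          ∏ k, ((∏ i, τ k (v k i).1 (v k i).2) * bestWeight (n k * T) Finset.univ
            ((G.multi (n k)).weight fun i => (v k i).1)) := by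
        refine ENNReal.tsum_le_tsum fun v => ?_
        rw [Finset.prod_mul_distrib]
        -- The query bound holds only for trees in the support; all other terms have weight zero.
        by_cases hv : ∀ k i, (v k i).2 ∈ (τ k (v k i).1).support
        · refine mul_le_mul_right ?_ _
          have h := sum_prod_run_le_prod_bestWeight
            (fun k => (G.multi (n k)).weight fun i => (v k i).1) _ Finset.univ
            (fun k => n k * T) (fun _ => Finset.univ) (fun k => sequence (n k) fun i => (v k i).2)
            (fun k _ => queriesAtMost_sequence _ _ fun i => hτ k _ _ (hv k i))
            (fun k hk => (hk (Finset.mem_univ k)).elim) le_rfl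
          rwa [Fintype.piFinset_univ] at h
        · push Not at hv
          obtain ⟨k, i, hki⟩ := hv
          rw [PMF.mem_support_iff, not_not] at hki
          rw [Finset.prod_eq_zero (Finset.mem_univ k)
            (Finset.prod_eq_zero (Finset.mem_univ i) hki), zero_mul, zero_mul]
    _ ≤ ∏ k, (G.multi (n k)).eps (n k * T) := by
        rw [← prod_tsum_eq_tsum_prod K fun k (v : Fin (n k) → C × DecisionTree (Fin K × X) Y A) =>
          (∏ i, τ k (v i).1 (v i).2) * bestWeight (n k * T) Finset.univ
            ((G.multi (n k)).weight fun i => (v i).1)]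
        exact Finset.prod_le_prod' fun k _ => G.tsum_prod_mul_bestWeight_le_eps (τ k) _ _

/-- The multinomial expansion reduces the L-th moment to the mixed moments bounded by the direct
product theorem. -/
theorem sum_iid_mul_mean_answerProb_pow_le [Fintype (X → Y)] (G : Game X Y C A) (K T L : ℕ)
    (τ : Fin K → C → PMF (DecisionTree (Fin K × X) Y A))
    (hτ : ∀ k ch, ∀ t ∈ (τ k ch).support, t.QueriesAtMost T) :
    ∑ fs, iid K G.μ fs *
        ((K : ℝ≥0∞)⁻¹ * ∑ k, G.answerProb (τ k) (fs k) fun p => fs p.1 p.2) ^ L ≤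
      ((L ! : ℕ) : ℝ≥0∞) / (K : ℝ≥0∞) ^ L *
        ∑ n ∈ (Finset.univ : Finset (Fin K)).piAntidiag L,
          ∏ k : Fin K, (G.multi (n k)).eps (n k * T) / ((n k)! : ℝ≥0∞) := by
  calc ∑ fs, iid K G.μ fs *
        ((K : ℝ≥0∞)⁻¹ * ∑ k, G.answerProb (τ k) (fs k) fun p => fs p.1 p.2) ^ L
      = ((L ! : ℕ) : ℝ≥0∞) / (K : ℝ≥0∞) ^ L *
        ∑ n ∈ (Finset.univ : Finset (Fin K)).piAntidiag L, (∏ k, ((n k)! : ℝ≥0∞)⁻¹) *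
          ∑ fs, iid K G.μ fs * ∏ k, G.answerProb (τ k) (fs k) (fun p => fs p.1 p.2) ^ n k := by
        simp only [mul_pow, sum_pow_eq_sum_piAntidiag_factorial]
        simp only [Finset.mul_sum]
        rw [Finset.sum_comm]
        refine Finset.sum_congr rfl fun n _ => Finset.sum_congr rfl fun fs _ => ?_
        rw [div_eq_mul_inv, ENNReal.inv_pow]
        ring
    _ ≤ _ := by
        refine mul_le_mul_right (Finset.sum_le_sum fun n _ => ?_) _
        simp only [div_eq_mul_inv, Finset.prod_mul_distrib]
        rw [mul_comm (∏ k, (G.multi (n k)).eps (n k * T))]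
        exact mul_le_mul_right (G.sum_iid_mul_prod_answerProb_pow_le K T τ hτ n) _

end Game

end Salting

/-! ### Jensen's inequality and the union over advice strings -/

theorem mainTheorem7 {X Y C A : Type*} [Finite X] [Finite Y] (G : Salting.Game X Y C A)
    (K : ℕ) [NeZero K] (S T : ℕ) :
    (G.salted K).epsAdvice S T ≤
      ⨅ L : ℕ+, (2 : ℝ≥0∞) ^ ((S : ℝ) / ((L : ℕ) : ℝ)) *
        ((((L : ℕ) ! : ℕ) : ℝ≥0∞) / (K : ℝ≥0∞) ^ (L : ℕ) *
          ∑ n ∈ (Finset.univ : Finset (Fin K)).piAntidiag (L : ℕ),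
            ∏ k : Fin K, (G.multi (n k)).eps (n k * T) / ((n k)! : ℝ≥0∞)) ^
          (1 / ((L : ℕ) : ℝ)) := by
  classical
  have := Fintype.ofFinite (X → Y)
  refine iSup₂_le fun 𝒜 σ => le_iInf fun L => ?_
  have hL : (0 : ℝ) < (L : ℕ) := by exact_mod_cast L.pos
  set M := (((L : ℕ) ! : ℕ) : ℝ≥0∞) / (K : ℝ≥0∞) ^ (L : ℕ) *
    ∑ n ∈ (Finset.univ : Finset (Fin K)).piAntidiag (L : ℕ),
      ∏ k : Fin K, (G.multi (n k)).eps (n k * T) / ((n k)! : ℝ≥0∞)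
  have hroot (M : ℝ≥0∞) : (2 : ℝ≥0∞) ^ ((S : ℝ) / ((L : ℕ) : ℝ)) * M ^ (1 / ((L : ℕ) : ℝ)) =
      ((2 : ℝ≥0∞) ^ S * M) ^ (1 / ((L : ℕ) : ℝ)) := by
    rw [ENNReal.mul_rpow_of_nonneg _ _ (by positivity), ← ENNReal.rpow_natCast,
      ← ENNReal.rpow_mul, mul_one_div]
  rw [hroot, one_div, ENNReal.le_rpow_inv_iff hL, G.winProb_salted, tsum_fintype]
  let q (s : Fin S → Bool) (fs : Fin K → X → Y) : ℝ≥0∞ := (K : ℝ≥0∞)⁻¹ * ∑ k,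
    G.answerProb (fun ch => 𝒜.tree (s, (k, ch))) (fs k) fun p => fs p.1 p.2
  calc (∑ fs, Salting.iid K G.μ fs * q (σ fun p => fs p.1 p.2) fs) ^ ((L : ℕ) : ℝ)
      ≤ ∑ fs, Salting.iid K G.μ fs * q (σ fun p => fs p.1 p.2) fs ^ ((L : ℕ) : ℝ) := by
        refine ENNReal.rpow_arith_mean_le_arith_mean_rpow _ _ _ ?_ (Nat.one_le_cast.mpr L.pos)
        rw [← tsum_fintype (L := .unconditional _), PMF.tsum_coe]
    -- The term of the actual advice is bounded by the sum over all strings, which decouples `s`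
    -- from `fs`.
    _ ≤ ∑ fs, ∑ s, Salting.iid K G.μ fs * q s fs ^ (L : ℕ) := by
        refine Finset.sum_le_sum fun fs _ => ?_
        rw [ENNReal.rpow_natCast]
        exact Finset.single_le_sum (f := fun s => Salting.iid K G.μ fs * q s fs ^ (L : ℕ))
          (fun _ _ => zero_le) (Finset.mem_univ _)
    _ = ∑ s, ∑ fs, Salting.iid K G.μ fs * q s fs ^ (L : ℕ) := Finset.sum_comm
    _ ≤ ∑ s : Fin S → Bool, M := Finset.sum_le_sum fun s _ =>
        G.sum_iid_mul_mean_answerProb_pow_le K T L (fun k ch => 𝒜.tree (s, (k, ch)))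
          fun k ch => 𝒜.queriesAtMost _
    _ = 2 ^ S * M := by simp
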